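/- Let $(W_s)_{s\ge 0}$ be a standard real Brownian motion, let $G$ be a random vector in $\mathbb{R}^{2d}$ with density $f_G$ with respect to Lebesgue measure, independent of $W$, and let $f:\mathbb{R}\times\mathbb{R}^{2d}\to\mathbb{R}$ be measurable. Write $f_z(x)=f(x,z)$; for $u\in\mathbb{R}^{2d-1}$ and $x\in\mathbb{R}$ let $\iota_i(x,u)\in\mathbb{R}^{2d}$ be the vector with $i$-th coordinate $x$ and remaining coordinates $u$; let $f_{G_i}(x)=\int_{\mathbb{R}^{2d-1}} f_G(\iota_i(x,u))\,du$ be the density of $G_i$ and $f_G(u\mid x)=f_G(\iota_i(x,u))/f_{G_i}(x)$ the conditional density of the other coordinates given $G_i=x$. Suppose: 1. For every $z\in\mathbb{R}^{2d}$, $f_z$ is a difference of two convex functions on $\mathbb{R}$ (so that the Itô–Tanaka formula $f_z(W_t)=f_z(0)+\int_0^t D_-f_z(W_s)\,dW_s+\frac12\int_{\mathbb{R}} L^y_t(W)\,D^2f_z(dy)$ applies, where $D_-f_z$ is the left derivative, $D^2f_z$ the second distributional derivative and $L^y_t(W)$ the local time). 2. For every $z$, $f_z(0)=0$. 3. For every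 $z$, $D_-f_z$ has at most polynomial growth (so that the stochastic integral in 1 is a martingale). 4. For every $z$, $D^2f_z(dy)=f_z''(y)\,dy+\sum_{i=1}^{2d}\gamma^i_z\,\delta_{z_i}(dy)$, where $f_z''$ is locally integrable, and $(y,z)\mapsto f_z''(y)$ and the $z\mapsto\gamma^i_z$ are measurable. Put $$h_0(x)=\mathbb{E}[f_G''(x)],\qquad h_i(x)=\Big(\int_{\mathbb{R}^{2d-1}}\gamma^i_{\iota_i(x,u)}\,f_G(u\mid x)\,du\Big)f_{G_i}(x),\quad 1\le i\le 2d,$$ and assume that the expectations involved converge absolutely for small times, that is, for all sufficiently small $t>0$, $$\mathbb{E}|f(W_t,G)|<\infty,\qquad \mathbb{E}|f_G''(W_t)|<\infty,\qquad \mathbb{E}\int_{\mathbb{R}^{2d-1}}\big|\gamma^i_{\iota_i(W_t,u)}\big|\,f_G(\iota_i(W_t,u))\,du<\infty\quad(1\le i\le 2d).$$ (a) If moreover 5. $t\mapsto\mathbb{E}[f_G''(W_t)]$ is bounded for small $t>0$, and 6. for every $i$, $t\mapsto\mathbb{E}[h_i(W_t)]$ is bounded for small $t>0$, then $\mathbb{E}[f(W_t,G)]=O(t)$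 as $t\to0^+$. (b) If, instead of 5 and 6, 5'. $h_0(0)=0$ and $h_0$ is twice differentiable, with first and second derivatives of at most polynomial growth, and 6'. for every $i$, $h_i(0)=0$ and $h_i\in\mathcal{C}^2$, with $h_i'$ and $h_i''$ of at most polynomial growth, then $\mathbb{E}[f(W_t,G)]=O(t^2)$ as $t\to0^+$. -/

import Mathlib

open MeasureTheory ProbabilityTheory Filter Topology
open scoped NNReal ENNReal

namespace ItoTanaka

/-- `g` is a difference of two convex functions on `ℝ`. This is the class of functions to which the
Itô–Tanaka formula
`g(W_t) = g(0) + ∫₀ᵗ D₋g(W_s) dW_s + (1/2) ∫ L_t^y(W) D²g(dy)` applies. -/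
def IsDiffConvex (g : ℝ → ℝ) : Prop :=
  ∃ u v : ℝ → ℝ, ConvexOn ℝ Set.univ u ∧ ConvexOn ℝ Set.univ v ∧ ∀ x, g x = u x - v x

/-- The left derivative `D₋g`. -/
noncomputable def leftDeriv (g : ℝ → ℝ) (x : ℝ) : ℝ := derivWithin g (Set.Iic x) x

/-- `g` has at most polynomial growth. -/
def PolyGrowth (g : ℝ → ℝ) : Prop :=
  ∃ C : ℝ, ∃ k : ℕ, ∀ x, |g x| ≤ C * (1 + |x| ^ k)

/-- The second distributional derivative of `g` is the measure
`g₂(y) dy + ∑ i, c i • δ_{z i}(dy)`, with `g₂` locally integrable. -/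
def HasSecondDistribDeriv {ι : Type*} [Fintype ι] (g g₂ : ℝ → ℝ) (c z : ι → ℝ) : Prop :=
  LocallyIntegrable g₂ volume ∧
    ∀ φ : ℝ → ℝ, ContDiff ℝ (⊤ : ℕ∞) φ → HasCompactSupport φ →
      ∫ x, g x * deriv (deriv φ) x = (∫ y, g₂ y * φ y) + ∑ i, c i * φ (z i)

section Coordinates

variable {ι : Type*} [DecidableEq ι]

/-- The vector whose `i`-th coordinate is `x` and whose other coordinates are those of `u`. -/
def insertCoord (i : ι) (x : ℝ) (u : {j // j ≠ i} → ℝ) : ι → ℝ :=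
  fun j => if h : j = i then x else u ⟨j, h⟩

variable [Fintype ι]

/-- The density of the `i`-th coordinate of a vector with density `ρ`. -/
noncomputable def marginalDensity (ρ : (ι → ℝ) → ℝ) (i : ι) (x : ℝ) : ℝ :=
  ∫ u : {j // j ≠ i} → ℝ, ρ (insertCoord i x u)

/-- The conditional density, given that the `i`-th coordinate is `x`, of the other coordinates `u`
of a vector with density `ρ`. -/
noncomputable def condDensity (ρ : (ι → ℝ) → ℝ) (i : ι) (u : {j // j ≠ i} → ℝ) (x : ℝ) : ℝ :=
  ρ (insertCoord i x u) / marginalDensity ρ i x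

/-- The averaged weight
`h_i(x) = (∫ γ^i(z with z_i = x) ρ(other coordinates | x)) * ρ_i(x)`. -/
noncomputable def avgWeight (ρ : (ι → ℝ) → ℝ) (γ : ι → (ι → ℝ) → ℝ) (i : ι) (x : ℝ) : ℝ :=
  (∫ u : {j // j ≠ i} → ℝ, γ i (insertCoord i x u) * condDensity ρ i u x) * marginalDensity ρ i x

end Coordinates

/-- The averaged density `h_0(x) = E[f_G''(x)]`, where `f₂ x z` is `f_z''(x)`. -/
noncomputable def avgDensity {ι Ω : Type*} [MeasurableSpace Ω] (P : Measure Ω) (G : Ω → ι → ℝ)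
    (f₂ : ℝ → (ι → ℝ) → ℝ) (x : ℝ) : ℝ :=
  ∫ ω, f₂ x (G ω) ∂P

end ItoTanaka

/-! The Itô–Tanaka formula is needed only in expectation, where it becomes deterministic: only the
Gaussian law of $W_t$ and its independence of $G$ enter. A continuous $g$ with $g(0)=0$ is recovered
from its second distributional derivative by the Green kernel `green`, up to a linear term:
$g(x)=bx+\int \mathrm{green}(x,y)\,D^2g(dy)$. Under the centred Gaussian law the linear term has
mean zero, and the mean of $\mathrm{green}(\cdot,y)$ is half of `expLocalTime t y` $=\int_0^t
p_s(y)\,ds$, with $p_s$ the density `heat s` (`integral_green_mul_heat`).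

Averaging over $G$ and applying Fubini gives, for small $t$,
$\mathbb{E}f(W_t,G)=\frac12\int_0^t\big(\mathbb{E}f_G''(W_s)+\sum_i\mathbb{E}h_i(W_s)\big)\,ds$
(`integral_eq_of_hasSecondDistribDeriv`, with `integral_avgWeight_gaussianReal` for the Dirac part).
A bounded integrand gives $O(t)$. If $h_0$ and the $h_i$ vanish at $0$ and have second derivatives
of polynomial growth, Taylor expansion makes the integrand $O(s)$
(`exists_abs_integral_gaussianReal_le`), whence $O(t^2)$. -/

namespace ItoTanaka

/-! ### The Gaussian density and its domination in time. -/

/-- The centred Gaussian density of variance `s`. -/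
noncomputable def heat (s y : ℝ) : ℝ := (√(2 * Real.pi * s))⁻¹ * Real.exp (-y ^ 2 / (2 * s))

lemma gaussianPDFReal_eq_heat (s : ℝ≥0) (y : ℝ) : gaussianPDFReal 0 s y = heat s y := by
  simp [gaussianPDFReal, heat]

lemma measurable_uncurry_heat : Measurable (Function.uncurry heat) := by
  unfold heat Function.uncurry
  fun_prop

lemma heat_nonneg (s y : ℝ) : 0 ≤ heat s y := by unfold heat; positivity

lemma heat_neg (s y : ℝ) : heat s (-y) = heat s y := by simp [heat]

lemma integrable_heat (s : ℝ) : Integrable (heat s) := by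
  rcases le_total 0 s with hs | hs
  · lift s to ℝ≥0 using hs
    exact (integrable_gaussianPDFReal 0 s).congr
      (Eventually.of_forall fun y => gaussianPDFReal_eq_heat s y)
  -- For $s\le 0$ the real square root is zero and so is its inverse, by convention.
  · have : heat s = 0 := by
      ext y
      have : √(2 * Real.pi * s) = 0 :=
        Real.sqrt_eq_zero'.2 (mul_nonpos_of_nonneg_of_nonpos (by positivity) hs)
      simp [heat, this]
    rw [this]
    exact integrable_zero _ _ _

lemma continuous_heat (s : ℝ) : Continuous (heat s) := by unfold heat; fun_prop

/-- The exponential factor increases with time, and the prefactors differ by $\sqrt{t/s}$. Since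
$s^{-1/2}$ is integrable at $0$, integrability against the density at time $t$ controls the whole
interval $(0,t]$. -/
lemma heat_le {s t : ℝ} (hs : 0 < s) (hst : s ≤ t) (y : ℝ) :
    heat s y ≤ √t * s ^ (-(1 / 2) : ℝ) * heat t y := by
  have ht : 0 < t := hs.trans_le hst
  have h1 : s ^ (-(1 / 2) : ℝ) = (√s)⁻¹ := by
    rw [Real.rpow_neg hs.le, Real.sqrt_eq_rpow]
  have h2 : Real.exp (-y ^ 2 / (2 * s)) ≤ Real.exp (-y ^ 2 / (2 * t)) := by
    apply Real.exp_le_exp.2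
    rw [neg_div, neg_div]
    gcongr
  have h3 : √t * (√s)⁻¹ * (√(2 * Real.pi * t))⁻¹ = (√(2 * Real.pi * s))⁻¹ := by
    rw [Real.sqrt_mul (by positivity), Real.sqrt_mul (x := 2 * Real.pi) (by positivity)]
    have := Real.sqrt_pos.2 ht
    have := Real.sqrt_pos.2 hs
    field_simp
  rw [h1, heat, heat, ← mul_assoc, h3]
  gcongr

lemma intervalIntegrable_rpow_neg_half (t : ℝ) :
    IntervalIntegrable (fun s : ℝ => s ^ (-(1 / 2) : ℝ)) volume 0 t :=
  intervalIntegral.intervalIntegrable_rpow' (by norm_num)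

/-- Domination by the last time makes the time integral of a Gaussian weight converge. -/
lemma integrable_heat_mul_prod {X : Type*} [MeasurableSpace X] {ν : Measure X} [SFinite ν]
    {Y F : X → ℝ} (hY : Measurable Y) (hF : AEStronglyMeasurable F ν) {t : ℝ} (ht : 0 < t)
    (hint : Integrable (fun x => heat t (Y x) * F x) ν) :
    Integrable (fun q : ℝ × X => heat q.1 (Y q.2) * F q.2)
      ((volume.restrict (Set.Ioc 0 t)).prod ν) := by
  have h1 : Integrable (fun s : ℝ => √t * s ^ (-(1 / 2) : ℝ)) (volume.restrict (Set.Ioc 0 t)) :=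
    ((intervalIntegrable_iff_integrableOn_Ioc_of_le ht.le).1
      (intervalIntegrable_rpow_neg_half t)).const_mul _
  refine (h1.mul_prod hint).mono ?_ ?_
  · refine AEStronglyMeasurable.mul ?_ hF.comp_snd
    exact (measurable_uncurry_heat.comp
      (measurable_fst.prodMk (hY.comp measurable_snd))).aestronglyMeasurable
  · have : ∀ᵐ q : ℝ × X ∂((volume.restrict (Set.Ioc 0 t)).prod ν), q.1 ∈ Set.Ioc 0 t :=
      Measure.quasiMeasurePreserving_fst.ae (ae_restrict_mem measurableSet_Ioc)
    filter_upwards [this] with q hq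
    have hc : 0 ≤ √t * q.1 ^ (-(1 / 2) : ℝ) :=
      mul_nonneg (Real.sqrt_nonneg _) (Real.rpow_nonneg hq.1.le _)
    rw [← mul_assoc, norm_mul, norm_mul _ (F q.2), Real.norm_of_nonneg (heat_nonneg _ _),
      Real.norm_of_nonneg (mul_nonneg hc (heat_nonneg _ _))]
    exact mul_le_mul_of_nonneg_right (heat_le hq.1 hq.2 (Y q.2)) (norm_nonneg _)

/-! ### Expected local time and Fubini in time. -/

/-- The expected local time at `y` up to time `t`. -/
noncomputable def expLocalTime (t y : ℝ) : ℝ := ∫ s in 0..t, heat s y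

/-- The map `Y` lets one statement serve both parts of the second derivative: a space variable for
the absolutely continuous part, a coordinate $z_i$ for the Dirac masses. -/
lemma integrable_expLocalTime_mul {X : Type*} [MeasurableSpace X] {ν : Measure X} [SFinite ν]
    {Y F : X → ℝ} (hY : Measurable Y) (hF : AEStronglyMeasurable F ν) {t : ℝ} (ht : 0 < t)
    (hint : Integrable (fun x => heat t (Y x) * F x) ν) :
    Integrable (fun x => expLocalTime t (Y x) * F x) ν := by
  have := (integrable_heat_mul_prod hY hF ht hint).integral_prod_right
  simp only [← intervalIntegral.integral_of_le ht.le, intervalIntegral.integral_mul_const] at this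
  exact this

lemma integral_expLocalTime_mul {X : Type*} [MeasurableSpace X] {ν : Measure X} [SFinite ν]
    {Y F : X → ℝ} (hY : Measurable Y) (hF : AEStronglyMeasurable F ν) {t : ℝ} (ht : 0 < t)
    (hint : Integrable (fun x => heat t (Y x) * F x) ν) :
    ∫ x, expLocalTime t (Y x) * F x ∂ν = ∫ s in 0..t, ∫ x, heat s (Y x) * F x ∂ν := by
  rw [intervalIntegral.integral_of_le ht.le,
    integral_integral_swap (integrable_heat_mul_prod hY hF ht hint)]
  simp only [← intervalIntegral.integral_of_le ht.le, intervalIntegral.integral_mul_const]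
  rfl

lemma expLocalTime_neg (t y : ℝ) : expLocalTime t (-y) = expLocalTime t y := by
  simp [expLocalTime, heat_neg]

/-! ### The mean of $(W_t-y)^+$ as a time integral. -/

/-- The upper tail of the standard Gaussian law. -/
noncomputable def gaussTail (r : ℝ) : ℝ := ∫ x in Set.Ioi r, heat 1 x

lemma gaussTail_eq (r : ℝ) :
    gaussTail r = gaussTail 0 - ∫ x in 0..r, heat 1 x := by
  rw [eq_sub_iff_add_eq, add_comm]
  exact intervalIntegral.integral_interval_add_Ioi (integrable_heat 1).integrableOn
    (integrable_heat 1).integrableOn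

lemma hasDerivAt_gaussTail (r : ℝ) : HasDerivAt gaussTail (-heat 1 r) r := by
  have h : gaussTail = fun r => gaussTail 0 - ∫ x in 0..r, heat 1 x := funext gaussTail_eq
  rw [h]
  exact (intervalIntegral.integral_hasDerivAt_right ((integrable_heat 1).intervalIntegrable)
    ((continuous_heat 1).stronglyMeasurableAtFilter _ _) (continuous_heat 1).continuousAt).const_sub _

lemma tendsto_gaussTail : Tendsto gaussTail atTop (𝓝 0) := by
  have h : gaussTail = fun r => gaussTail 0 - ∫ x in 0..r, heat 1 x := funext gaussTail_eq
  rw [h]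
  simpa [gaussTail] using (intervalIntegral_tendsto_integral_Ioi 0
    (integrable_heat 1).integrableOn tendsto_id).const_sub (gaussTail 0)

lemma heat_eq_scale {t : ℝ} (ht : 0 < t) (x : ℝ) : heat t x = (√t)⁻¹ * heat 1 ((√t)⁻¹ * x) := by
  have h : ((√t)⁻¹ * x) ^ 2 = x ^ 2 / t := by
    rw [mul_pow, inv_pow, Real.sq_sqrt ht.le]; field_simp
  rw [heat, heat, Real.sqrt_mul (by positivity), h, mul_inv]
  simp only [mul_one]
  rw [show -x ^ 2 / (2 * t) = -(x ^ 2 / t) / 2 by field_simp]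
  ring

lemma setIntegral_Ioi_heat {t : ℝ} (ht : 0 < t) (y : ℝ) :
    ∫ x in Set.Ioi y, heat t x = gaussTail ((√t)⁻¹ * y) := by
  have h : 0 < (√t)⁻¹ := by positivity
  simp only [heat_eq_scale ht]
  rw [integral_const_mul, integral_comp_mul_left_Ioi (heat 1) y h, gaussTail, smul_eq_mul,
    ← mul_assoc, mul_inv_cancel₀ h.ne', one_mul]

lemma hasDerivAt_heat {t : ℝ} (ht : 0 < t) (x : ℝ) :
    HasDerivAt (fun x => -(t * heat t x)) (x * heat t x) x := by
  unfold heat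
  have h : HasDerivAt (fun x : ℝ => -x ^ 2 / (2 * t)) (-(2 * x) / (2 * t)) x := by
    simpa using ((hasDerivAt_pow 2 x).neg.div_const (2 * t))
  convert! ((h.exp.const_mul (√(2 * Real.pi * t))⁻¹).const_mul t).neg using 1
  field_simp

lemma tendsto_heat_atTop {t : ℝ} (ht : 0 < t) : Tendsto (fun x => heat t x) atTop (𝓝 0) := by
  have h : Tendsto (fun x : ℝ => -x ^ 2 / (2 * t)) atTop atBot := by
    simp only [neg_div]
    exact tendsto_neg_atTop_atBot.comp
      ((tendsto_pow_atTop two_ne_zero).atTop_div_const (by positivity))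
  simpa [heat, funext_iff, Function.comp_def] using (Real.tendsto_exp_atBot.comp h).const_mul (√(2 * Real.pi * t))⁻¹

lemma integrableOn_Ioi_mul_heat {t y : ℝ} (ht : 0 < t) (hy : 0 ≤ y) :
    IntegrableOn (fun x => x * heat t x) (Set.Ioi y) :=
  integrableOn_Ioi_deriv_of_nonneg' (fun x _ => hasDerivAt_heat ht x)
    (fun _ hx => mul_nonneg (hy.trans (le_of_lt hx)) (heat_nonneg _ _))
    (((tendsto_heat_atTop ht).const_mul t).neg)

lemma setIntegral_Ioi_mul_heat {t y : ℝ} (ht : 0 < t) (hy : 0 ≤ y) :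
    ∫ x in Set.Ioi y, x * heat t x = t * heat t y := by
  rw [integral_Ioi_of_hasDerivAt_of_nonneg' (fun x _ => hasDerivAt_heat ht x)
    (fun _ hx => mul_nonneg (hy.trans (le_of_lt hx)) (heat_nonneg _ _))
    (((tendsto_heat_atTop ht).const_mul t).neg)]
  simp

lemma setIntegral_Ioi_sub_mul_heat {t y : ℝ} (ht : 0 < t) (hy : 0 ≤ y) :
    ∫ x in Set.Ioi y, (x - y) * heat t x = t * heat t y - y * gaussTail ((√t)⁻¹ * y) := by
  simp only [sub_mul]
  rw [integral_sub (integrableOn_Ioi_mul_heat ht hy)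
    ((integrable_heat t).integrableOn.const_mul y), setIntegral_Ioi_mul_heat ht hy,
    integral_const_mul, setIntegral_Ioi_heat ht]

/-- The function is the closed form of the mean of $(W_s-y)^+$. The derivative of the exponential
and that of the tail cancel, leaving only the contribution of the prefactor $\sqrt s$. -/
lemma hasDerivAt_time {s : ℝ} (hs : 0 < s) (y : ℝ) :
    HasDerivAt (fun s => s * heat s y - y * gaussTail ((√s)⁻¹ * y)) (heat s y / 2) s := by
  have hsq := Real.sqrt_pos.2 hs
  have h1 : HasDerivAt (fun s : ℝ => (√s)⁻¹) (-(1 / (2 * √s)) / √s ^ 2) s :=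
    (Real.hasDerivAt_sqrt hs.ne').inv hsq.ne'
  have h2 : HasDerivAt (fun s : ℝ => √s * ((√(2 * Real.pi))⁻¹ * Real.exp (-y ^ 2 / 2 * s⁻¹)))
      (1 / (2 * √s) * ((√(2 * Real.pi))⁻¹ * Real.exp (-y ^ 2 / 2 * s⁻¹)) +
        √s * ((√(2 * Real.pi))⁻¹ * (Real.exp (-y ^ 2 / 2 * s⁻¹) *
          (-y ^ 2 / 2 * (-(s ^ 2)⁻¹))))) s :=
    (Real.hasDerivAt_sqrt hs.ne').mul
      (((hasDerivAt_inv hs.ne').const_mul _).exp.const_mul _)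
  have h3 : HasDerivAt (fun s => y * gaussTail ((√s)⁻¹ * y)) _ s :=
    (((hasDerivAt_gaussTail _).comp s (h1.mul_const y))).const_mul y
  have hform : ∀ s : ℝ, 0 < s →
      heat s y = (√s)⁻¹ * ((√(2 * Real.pi))⁻¹ * Real.exp (-y ^ 2 / 2 * s⁻¹)) := by
    intro s hs
    rw [heat, Real.sqrt_mul (by positivity), mul_inv]
    rw [show -y ^ 2 / (2 * s) = -y ^ 2 / 2 * s⁻¹ by field_simp]
    ring
  have h4 : (fun s => s * heat s y) =ᶠ[𝓝 s]
      (fun s : ℝ => √s * ((√(2 * Real.pi))⁻¹ * Real.exp (-y ^ 2 / 2 * s⁻¹))) := by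
    filter_upwards [lt_mem_nhds hs] with r hr
    have := Real.sqrt_pos.2 hr
    rw [hform r hr, ← mul_assoc]
    congr 1
    rw [← div_eq_mul_inv, Real.div_sqrt]
  have h5 : heat 1 ((√s)⁻¹ * y) = √s * heat s y := by
    rw [heat_eq_scale hs, ← mul_assoc, mul_inv_cancel₀ hsq.ne', one_mul]
  refine ((h2.congr_of_eventuallyEq h4).sub h3).congr_deriv ?_
  rw [h5, hform s hs]
  have hs2 : s = √s ^ 2 := (Real.sq_sqrt hs.le).symm
  generalize Real.exp (-y ^ 2 / 2 * s⁻¹) = E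
  generalize √s = r at *
  subst hs2
  field_simp
  ring

/-- The mean of `(W_t - y)⁺` is half the expected local time at `y ≥ 0`. -/
lemma setIntegral_Ioi_sub_mul_heat_eq {t y : ℝ} (ht : 0 < t) (hy : 0 ≤ y) :
    ∫ x in Set.Ioi y, (x - y) * heat t x = expLocalTime t y / 2 := by
  have hint : IntervalIntegrable (fun s => heat s y / 2) volume 0 t := by
    rw [intervalIntegrable_iff_integrableOn_Ioc_of_le ht.le]
    have h1 := (((intervalIntegrable_iff_integrableOn_Ioc_of_le ht.le).1
      (intervalIntegrable_rpow_neg_half t)).const_mul √t).mul_const (heat t y)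
    refine (Integrable.mono' h1 ?_ ?_).div_const 2
    · exact (measurable_uncurry_heat.comp
        (measurable_id.prodMk measurable_const)).aestronglyMeasurable
    · filter_upwards [ae_restrict_mem measurableSet_Ioc] with s hs
      rw [Real.norm_of_nonneg (heat_nonneg _ _)]
      exact heat_le hs.1 hs.2 y
  -- The first term is at most $\sqrt s$. In the second the tail is taken at a point going to
  -- infinity if $y>0$, and the factor $y$ kills it if $y=0$.
  have h0 : Tendsto (fun s => s * heat s y - y * gaussTail ((√s)⁻¹ * y)) (𝓝[>] 0) (𝓝 0) := by
    have ha : Tendsto (fun s => s * heat s y) (𝓝[>] 0) (𝓝 0) := by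
      have hb : Tendsto (fun s : ℝ => √s) (𝓝[>] 0) (𝓝 0) := by
        simpa using (Real.continuous_sqrt.tendsto 0).mono_left nhdsWithin_le_nhds
      refine squeeze_zero' ?_ ?_ hb
      · filter_upwards [self_mem_nhdsWithin] with s hs
        exact mul_nonneg (le_of_lt hs) (heat_nonneg _ _)
      · filter_upwards [self_mem_nhdsWithin] with s (hs : 0 < s)
        have h1 : heat s y ≤ (√s)⁻¹ * 1 := by
          unfold heat
          gcongr
          · nlinarith [Real.pi_gt_three]
          · exact Real.exp_le_one_iff.2
              (div_nonpos_of_nonpos_of_nonneg (by nlinarith [sq_nonneg y]) (by positivity))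
        calc s * heat s y ≤ s * ((√s)⁻¹ * 1) := by gcongr
          _ = √s := by rw [mul_one, ← div_eq_mul_inv, Real.div_sqrt]
    have hc : Tendsto (fun s => y * gaussTail ((√s)⁻¹ * y)) (𝓝[>] 0) (𝓝 0) := by
      rcases hy.eq_or_lt with rfl | hy
      · simp
      · have hb : Tendsto (fun s : ℝ => (√s)⁻¹) (𝓝[>] 0) atTop := by
          refine tendsto_inv_nhdsGT_zero.comp (tendsto_nhdsWithin_iff.2 ⟨?_, ?_⟩)
          · simpa using (Real.continuous_sqrt.tendsto 0).mono_left nhdsWithin_le_nhds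
          · filter_upwards [self_mem_nhdsWithin] with s hs using Real.sqrt_pos.2 hs
        simpa using (tendsto_gaussTail.comp (hb.atTop_mul_const hy)).const_mul y
    simpa using ha.sub hc
  have h := intervalIntegral.integral_eq_sub_of_hasDerivAt_of_tendsto ht
    (fun s hs => hasDerivAt_time hs.1 y) hint h0
    ((hasDerivAt_time ht y).continuousAt.tendsto.mono_left nhdsWithin_le_nhds)
  rw [setIntegral_Ioi_sub_mul_heat ht hy, ← sub_zero (_ - _), ← h, expLocalTime,
    intervalIntegral.integral_div]

/-! ### The Green kernel and its Gaussian mean. -/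

/-- The Green kernel of the second derivative on `ℝ` that vanishes together with its derivative
at the origin. -/
noncomputable def green (x y : ℝ) : ℝ := if 0 < y then max (x - y) 0 else max (y - x) 0

lemma green_nonneg (x y : ℝ) : 0 ≤ green x y := by unfold green; split_ifs <;> exact le_max_right _ _

lemma measurable_uncurry_green : Measurable (Function.uncurry green) := by
  unfold green Function.uncurry
  refine Measurable.ite (measurableSet_lt measurable_const measurable_snd) ?_ ?_ <;> fun_prop

lemma continuous_green (y : ℝ) : Continuous fun x => green x y := by
  unfold green
  split_ifs <;> fun_prop

lemma integral_max_sub_mul (F : ℝ → ℝ) (y : ℝ) :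
    ∫ x, max (x - y) 0 * F x = ∫ x in Set.Ioi y, (x - y) * F x := by
  rw [← integral_indicator measurableSet_Ioi]
  congr 1 with x
  by_cases hx : y < x
  · simp [hx, hx.le]
  · simp [hx, not_lt.1 hx]

/-- For $y\le 0$ the reflection $x\mapsto -x$ turns $(y-x)^+$ into $(x-(-y))^+$, and the density and
expected local time are even. -/
lemma integral_green_mul_heat {t : ℝ} (ht : 0 < t) (y : ℝ) :
    ∫ x, green x y * heat t x = expLocalTime t y / 2 := by
  by_cases hy : 0 < y
  · simp only [green, hy, if_true]
    rw [integral_max_sub_mul, setIntegral_Ioi_sub_mul_heat_eq ht hy.le]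
  · rw [← expLocalTime_neg, ← setIntegral_Ioi_sub_mul_heat_eq ht (by linarith : 0 ≤ -y),
      ← integral_max_sub_mul, ← integral_neg_eq_self]
    congr 1 with x
    simp only [green, hy, if_false, heat_neg]
    congr 2
    ring

lemma green_le_abs (x y : ℝ) : green x y ≤ |x| := by
  unfold green
  split_ifs with h
  · exact max_le (by linarith [le_abs_self x]) (abs_nonneg x)
  · exact max_le (by linarith [neg_abs_le x]) (abs_nonneg x)

/-! ### Gaussian laws and their products as densities. -/

lemma gaussianReal_eq_withDensity_heat {t : ℝ≥0} (ht : t ≠ 0) :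
    gaussianReal 0 t = volume.withDensity (fun x => ENNReal.ofReal (heat t x)) := by
  rw [gaussianReal_of_var_ne_zero 0 ht]
  congr 1 with x
  rw [gaussianPDF, gaussianPDFReal_eq_heat]

@[fun_prop]
lemma measurable_heat (s : ℝ) : Measurable (heat s) := (continuous_heat s).measurable

lemma gaussianReal_prod_eq_withDensity {X : Type*} [MeasurableSpace X] (μ : Measure X) [SFinite μ]
    {t : ℝ≥0} (ht : t ≠ 0) :
    (gaussianReal 0 t).prod μ =
      (volume.prod μ).withDensity (fun q => ENNReal.ofReal (heat t q.1)) := by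
  rw [gaussianReal_eq_withDensity_heat ht]
  exact prod_withDensity_left (measurable_heat t).ennreal_ofReal

lemma integrable_gaussianReal_prod_iff {X : Type*} [MeasurableSpace X] (μ : Measure X) [SFinite μ]
    {t : ℝ≥0} (ht : t ≠ 0) {F : ℝ × X → ℝ} :
    Integrable F ((gaussianReal 0 t).prod μ) ↔
      Integrable (fun q => heat t q.1 * F q) (volume.prod μ) := by
  rw [gaussianReal_prod_eq_withDensity μ ht, integrable_withDensity_iff_integrable_smul'
    (by fun_prop : Measurable fun q : ℝ × X => ENNReal.ofReal (heat t q.1)) (by simp)]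
  simp [ENNReal.toReal_ofReal (heat_nonneg _ _)]

lemma integral_gaussianReal_prod {X : Type*} [MeasurableSpace X] (μ : Measure X) [SFinite μ]
    {t : ℝ≥0} (ht : t ≠ 0) (F : ℝ × X → ℝ) :
    ∫ q, F q ∂((gaussianReal 0 t).prod μ) = ∫ q, heat t q.1 * F q ∂(volume.prod μ) := by
  rw [gaussianReal_prod_eq_withDensity μ ht, integral_withDensity_eq_integral_toReal_smul
    (by fun_prop : Measurable fun q : ℝ × X => ENNReal.ofReal (heat t q.1)) (by simp)]
  simp [ENNReal.toReal_ofReal (heat_nonneg _ _)]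

lemma integral_gaussianReal {t : ℝ≥0} (ht : t ≠ 0) (F : ℝ → ℝ) :
    ∫ x, F x ∂(gaussianReal 0 t) = ∫ x, heat t x * F x := by
  rw [gaussianReal_eq_withDensity_heat ht, integral_withDensity_eq_integral_toReal_smul
    (measurable_heat t).ennreal_ofReal (by simp)]
  simp [ENNReal.toReal_ofReal (heat_nonneg _ _)]

lemma integrable_pow_abs_gaussianReal (n : ℕ) (t : ℝ≥0) :
    Integrable (fun x : ℝ => |x| ^ n) (gaussianReal 0 t) := by
  simpa using (memLp_id_gaussianReal' (μ := 0) (v := t) n (by simp)).integrable_norm_pow'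

lemma integrable_green_gaussianReal (t : ℝ≥0) (y : ℝ) :
    Integrable (fun x => green x y) (gaussianReal 0 t) := by
  refine (integrable_pow_abs_gaussianReal 1 t).mono'
    (continuous_green y).aestronglyMeasurable (Eventually.of_forall fun x => ?_)
  rw [Real.norm_of_nonneg (green_nonneg _ _), pow_one]
  exact green_le_abs x y

lemma integral_green_gaussianReal {t : ℝ≥0} (ht : t ≠ 0) (y : ℝ) :
    ∫ x, green x y ∂(gaussianReal 0 t) = expLocalTime t y / 2 := by
  rw [integral_gaussianReal ht, ← integral_green_mul_heat (by positivity) y]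
  simp only [mul_comm]

/-! ### Distributions on the line with vanishing derivatives. -/

/-- A smooth compactly supported function of zero mean has a smooth compactly supported
primitive. -/
lemma exists_deriv_eq_of_integral_eq_zero {η : ℝ → ℝ} (hη : ContDiff ℝ (⊤ : ℕ∞) η)
    (hc : HasCompactSupport η) (h0 : ∫ x, η x = 0) :
    ∃ φ : ℝ → ℝ, ContDiff ℝ (⊤ : ℕ∞) φ ∧ HasCompactSupport φ ∧ deriv φ = η := by
  obtain ⟨R, hR⟩ := hc.isCompact.isBounded.subset_closedBall 0
  have hz : ∀ x, R < |x| → η x = 0 := fun x hx => by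
    by_contra h
    have := hR (subset_tsupport η h)
    rw [mem_closedBall_zero_iff, Real.norm_eq_abs] at this
    linarith
  -- A base point to the left of the support, with $|R|$ because $R$ may be negative. Beyond the
  -- support on the right the primitive is the full integral, which is zero.
  set a : ℝ := -(|R| + 1)
  have ha : ∀ x, x ≤ a → η x = 0 := fun x hx => hz x <| by
    have := le_abs_self R
    rw [lt_abs]; right; linarith
  have hd : ∀ x, HasDerivAt (fun x => ∫ t in a..x, η t) (η x) x := fun x =>
    intervalIntegral.integral_hasDerivAt_right (hη.continuous.intervalIntegrable _ _)
      (hη.continuous.stronglyMeasurableAtFilter _ _) hη.continuous.continuousAt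
  have hd' : deriv (fun x => ∫ t in a..x, η t) = η := funext fun x => (hd x).deriv
  refine ⟨fun x => ∫ t in a..x, η t, ?_, ?_, hd'⟩
  · exact contDiff_infty_iff_deriv.2 ⟨fun x => (hd x).differentiableAt, by rwa [hd']⟩
  · refine HasCompactSupport.intro (isCompact_closedBall (0 : ℝ) (|R| + 1)) fun x hx => ?_
    rw [mem_closedBall_zero_iff, Real.norm_eq_abs, not_le, lt_abs] at hx
    rcases hx with hx | hx
    · rw [intervalIntegral.integral_eq_integral_of_support_subset, h0]
      intro y hy
      constructor
      · by_contra h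
        exact hy (ha y (not_lt.1 h))
      · by_contra h
        exact hy (hz y (lt_of_le_of_lt (le_abs_self R)
          (lt_of_lt_of_le (by linarith [not_le.1 h]) (le_abs_self y))))
    · have : ∫ t in a..x, η t = ∫ t in a..x, (0 : ℝ) := by
        refine intervalIntegral.integral_congr fun t ht => ha t ?_
        rw [Set.uIcc_of_ge (by linarith : x ≤ a)] at ht
        exact ht.2
      simpa using this

lemma exists_test_integral_eq_one :
    ∃ η : ℝ → ℝ, ContDiff ℝ (⊤ : ℕ∞) η ∧ HasCompactSupport η ∧ ∫ x, η x = 1 := by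
  let b : ContDiffBump (0 : ℝ) := default
  exact ⟨b.normed volume, b.contDiff_normed, b.hasCompactSupport_normed, b.integral_normed⟩

lemma integrable_mul_test {u η : ℝ → ℝ} (hu : LocallyIntegrable u volume) (hη : Continuous η)
    (hc : HasCompactSupport η) : Integrable fun x => u x * η x := by
  simpa only [smul_eq_mul, mul_comm] using hu.integrable_smul_left_of_hasCompactSupport hη hc

/-- A locally integrable function whose distributional derivative vanishes is constant. -/
lemma ae_eq_const_of_integral_mul_deriv_eq_zero {u : ℝ → ℝ} (hu : LocallyIntegrable u volume)
    (h : ∀ φ : ℝ → ℝ, ContDiff ℝ (⊤ : ℕ∞) φ → HasCompactSupport φ → ∫ x, u x * deriv φ x = 0) :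
    ∃ c : ℝ, u =ᵐ[volume] fun _ => c := by
  obtain ⟨η₀, hs₀, hc₀, h₀⟩ := exists_test_integral_eq_one
  refine ⟨∫ x, u x * η₀ x, ?_⟩
  refine ae_eq_of_integral_contDiff_smul_eq hu (locallyIntegrable_const _) fun η hs hc => ?_
  -- Subtracting from `η` its mass times the unit-mass function `η₀` gives mean zero, hence the
  -- derivative of a test function.
  obtain ⟨φ, hφ, hφc, hφ'⟩ := exists_deriv_eq_of_integral_eq_zero
    (η := fun x => η x - (∫ y, η y) * η₀ x) (hs.sub (contDiff_const.mul hs₀))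
    (hc.sub (hc₀.mul_left)) (by
      rw [integral_sub (hs.continuous.integrable_of_hasCompactSupport hc)
        ((hs₀.continuous.integrable_of_hasCompactSupport hc₀).const_mul _), integral_const_mul, h₀]
      ring)
  have := h φ hφ hφc
  rw [hφ'] at this
  simp only [mul_sub, mul_left_comm (u _)] at this
  rw [integral_sub (integrable_mul_test hu hs.continuous hc)
    ((integrable_mul_test hu hs₀.continuous hc₀).const_mul _), integral_const_mul] at this
  simp only [smul_eq_mul, mul_comm (η _), integral_const_mul]
  rw [mul_comm (∫ x, u x * η₀ x)]
  linarith

lemma contDiff_deriv_top {φ : ℝ → ℝ} (hφ : ContDiff ℝ (⊤ : ℕ∞) φ) :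
    ContDiff ℝ (⊤ : ℕ∞) (deriv φ) := (contDiff_infty_iff_deriv.1 hφ).2

lemma integral_id_mul_deriv {η : ℝ → ℝ} (hs : ContDiff ℝ (⊤ : ℕ∞) η) (hc : HasCompactSupport η) :
    ∫ x, x * deriv η x = -∫ x, η x := by
  have hd : ∀ x, HasDerivAt (fun x => x * η x) (1 * η x + x * deriv η x) x := fun x =>
    (hasDerivAt_id x).mul ((hs.differentiable (by simp)) x).hasDerivAt
  have i1 : Integrable fun x => 1 * η x := by
    simpa using hs.continuous.integrable_of_hasCompactSupport hc
  have i2 : Integrable fun x => x * deriv η x :=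
    integrable_mul_test continuous_id.locallyIntegrable (contDiff_deriv_top hs).continuous hc.deriv
  have := integral_eq_zero_of_hasDerivAt_of_integrable hd (i1.add i2)
    (integrable_mul_test continuous_id.locallyIntegrable hs.continuous hc)
  rw [integral_add i1 i2] at this
  simp only [one_mul] at this
  linarith

/-- A continuous function whose second distributional derivative vanishes is affine. -/
lemma exists_affine_of_integral_mul_deriv_deriv_eq_zero {g : ℝ → ℝ} (hg : Continuous g)
    (h : ∀ φ : ℝ → ℝ, ContDiff ℝ (⊤ : ℕ∞) φ → HasCompactSupport φ →
      ∫ x, g x * deriv (deriv φ) x = 0) :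
    ∃ a b : ℝ, ∀ x, g x = a + b * x := by
  obtain ⟨η₀, hs₀, hc₀, h₀⟩ := exists_test_integral_eq_one
  have hgl := hg.locallyIntegrable (μ := volume)
  -- Minus the slope of `g`: by `key`, the distributional derivative of `g` is the constant $-c$, so
  -- $g+cx$ is constant.
  set c := ∫ x, g x * deriv η₀ x
  have key : ∀ η : ℝ → ℝ, ContDiff ℝ (⊤ : ℕ∞) η → HasCompactSupport η →
      ∫ x, g x * deriv η x = c * ∫ x, η x := by
    intro η hs hc
    obtain ⟨φ, hφ, hφc, hφ'⟩ := exists_deriv_eq_of_integral_eq_zero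
      (η := fun x => η x - (∫ y, η y) * η₀ x) (hs.sub (contDiff_const.mul hs₀))
      (hc.sub (hc₀.mul_left)) (by
        rw [integral_sub (hs.continuous.integrable_of_hasCompactSupport hc)
          ((hs₀.continuous.integrable_of_hasCompactSupport hc₀).const_mul _),
          integral_const_mul, h₀]
        ring)
    have h1 : deriv (deriv φ) = fun x => deriv η x - (∫ y, η y) * deriv η₀ x := by
      rw [hφ']
      ext x
      exact ((hs.differentiable (by simp) x).hasDerivAt.sub
        ((hs₀.differentiable (by simp) x).hasDerivAt.const_mul _)).deriv
    have := h φ hφ hφc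
    rw [h1] at this
    simp only [mul_sub, mul_left_comm (g _)] at this
    rw [integral_sub (integrable_mul_test hgl (contDiff_deriv_top hs).continuous hc.deriv)
      ((integrable_mul_test hgl (contDiff_deriv_top hs₀).continuous hc₀.deriv).const_mul _),
      integral_const_mul] at this
    linarith
  have hcont : Continuous fun x => g x + c * x := by fun_prop
  obtain ⟨a, ha⟩ := ae_eq_const_of_integral_mul_deriv_eq_zero (u := fun x => g x + c * x)
    hcont.locallyIntegrable (fun η hs hc => by
      simp only [add_mul, mul_assoc]
      rw [integral_add (integrable_mul_test hgl (contDiff_deriv_top hs).continuous hc.deriv)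
        ((integrable_mul_test (u := fun x => x) continuous_id.locallyIntegrable
          (contDiff_deriv_top hs).continuous hc.deriv).const_mul c), integral_const_mul, key η hs hc,
        integral_id_mul_deriv hs hc]
      ring)
  refine ⟨a, -c, fun x => ?_⟩
  have := congrFun ((hcont.ae_eq_iff_eq volume continuous_const).1 ha) x
  linarith

/-! ### Green potentials and recovery of a function from its second derivative. -/

/-- For $|x|\le R$ only $y\in[-R,R]$ contributes to a potential, so local integrability of the
density suffices, with no condition at infinity. -/
lemma green_eq_zero {x y : ℝ} (h : |x| ≤ |y|) : green x y = 0 := by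
  unfold green
  split_ifs with hy
  · exact max_eq_right (by linarith [le_abs_self x, abs_of_pos hy])
  · exact max_eq_right (by linarith [neg_abs_le x, abs_of_nonpos (not_lt.1 hy)])

/-- This is $\partial_x^2\,\mathrm{green}(\cdot,y)=\delta_y$. For $y>0$, $(x-y)\varphi'-\varphi$ is
a primitive of $(x-y)\varphi''$, equal to $-\varphi(y)$ at $y$ and zero at infinity; reflection
treats $y\le 0$. -/
lemma integral_green_mul_deriv_deriv {φ : ℝ → ℝ} (hs : ContDiff ℝ (⊤ : ℕ∞) φ)
    (hc : HasCompactSupport φ) (y : ℝ) : ∫ x, green x y * deriv (deriv φ) x = φ y := by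
  have key : ∀ (ψ : ℝ → ℝ) (y : ℝ), ContDiff ℝ (⊤ : ℕ∞) ψ → HasCompactSupport ψ →
      ∫ x, max (x - y) 0 * deriv (deriv ψ) x = ψ y := by
    intro ψ y hs hc
    have hd : ∀ x ∈ Set.Ici y, HasDerivAt (fun x => (x - y) * deriv ψ x - ψ x)
        ((x - y) * deriv (deriv ψ) x) x := fun x _ => by
      refine ((((hasDerivAt_id x).sub_const y).mul
        ((contDiff_deriv_top hs).differentiable (by simp) x).hasDerivAt).sub
        (hs.differentiable (by simp) x).hasDerivAt).congr_deriv ?_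
      simp
    have hi : Integrable fun x => (x - y) * deriv (deriv ψ) x :=
      integrable_mul_test (by fun_prop : Continuous fun x => x - y).locallyIntegrable
        (contDiff_deriv_top (contDiff_deriv_top hs)).continuous hc.deriv.deriv
    have hl : Tendsto (fun x => (x - y) * deriv ψ x - ψ x) atTop (𝓝 0) := by
      have h1 : HasCompactSupport fun x => (x - y) * deriv ψ x - ψ x :=
        (hc.deriv.mul_left (f := fun x => x - y)).sub hc
      exact h1.is_zero_at_infty.mono_left atTop_le_cocompact
    rw [integral_max_sub_mul, integral_Ioi_of_hasDerivAt_of_tendsto' hd hi.integrableOn hl]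
    simp
  by_cases hy : 0 < y
  · simpa only [green, hy, if_true] using key φ y hs hc
  · have h2 := key (fun x => φ (-x)) (-y) (hs.comp contDiff_neg)
      (hc.comp_homeomorph (Homeomorph.neg ℝ))
    have h3 : deriv (deriv fun x => φ (-x)) = fun x => deriv (deriv φ) (-x) := by
      have : (deriv fun x => φ (-x)) = fun x => -deriv φ (-x) := funext fun x => deriv_comp_neg φ x
      rw [this]
      ext x
      rw [deriv.fun_neg, deriv_comp_neg (deriv φ) x, neg_neg]
    rw [h3, neg_neg] at h2
    rw [← h2, ← integral_neg_eq_self]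
    congr 1 with x
    simp only [green, hy, if_false]
    congr 2
    ring

/-- The Green potential of a locally integrable function. -/
noncomputable def greenPotential (g₂ : ℝ → ℝ) (x : ℝ) : ℝ := ∫ y, green x y * g₂ y

lemma norm_green_mul_le {g₂ : ℝ → ℝ} {x R : ℝ} (hx : |x| ≤ R) (y : ℝ) :
    ‖green x y * g₂ y‖ ≤ R * ‖(Set.Icc (-R) R).indicator g₂ y‖ := by
  by_cases hy : y ∈ Set.Icc (-R) R
  · rw [Set.indicator_of_mem hy, norm_mul, Real.norm_of_nonneg (green_nonneg _ _)]
    gcongr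
    exact (green_le_abs x y).trans hx
  · have : R < |y| := by
      by_contra h
      exact hy (abs_le.1 (not_lt.1 h))
    rw [green_eq_zero (hx.trans this.le), Set.indicator_of_notMem hy]
    simp

lemma integrable_indicator_Icc {g₂ : ℝ → ℝ} (h : LocallyIntegrable g₂ volume) (R : ℝ) :
    Integrable ((Set.Icc (-R) R).indicator g₂) :=
  (h.integrableOn_isCompact isCompact_Icc).integrable_indicator measurableSet_Icc

lemma aestronglyMeasurable_green_mul {g₂ : ℝ → ℝ} (h : AEStronglyMeasurable g₂ volume) (x : ℝ) :
    AEStronglyMeasurable (fun y => green x y * g₂ y) volume :=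
  ((measurable_uncurry_green.comp (measurable_const.prodMk measurable_id)).aestronglyMeasurable).mul
    h

lemma continuous_greenPotential {g₂ : ℝ → ℝ} (h : LocallyIntegrable g₂ volume) :
    Continuous (greenPotential g₂) := by
  refine continuous_iff_continuousAt.2 fun x₀ => ?_
  refine continuousAt_of_dominated (bound := fun y => (|x₀| + 1) *
    ‖(Set.Icc (-(|x₀| + 1)) (|x₀| + 1)).indicator g₂ y‖) (Eventually.of_forall fun x =>
      aestronglyMeasurable_green_mul h.aestronglyMeasurable x) ?_
    ((integrable_indicator_Icc h _).norm.const_mul _) (Eventually.of_forall fun y =>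
      ((continuous_green y).mul continuous_const).continuousAt)
  have : ∀ᶠ x : ℝ in 𝓝 x₀, |x| < |x₀| + 1 :=
    continuous_abs.continuousAt.eventually_lt continuousAt_const (by simp)
  filter_upwards [this] with x hx
  exact Eventually.of_forall fun y => norm_green_mul_le hx.le y

/-- Fubini reduces this to a single kernel. It applies because the support of $\varphi''$ bounds
$x$, and the kernel then confines $y$ to the same interval. -/
lemma integral_greenPotential_mul_deriv_deriv {g₂ : ℝ → ℝ} (h : LocallyIntegrable g₂ volume)
    {φ : ℝ → ℝ} (hs : ContDiff ℝ (⊤ : ℕ∞) φ) (hc : HasCompactSupport φ) :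
    ∫ x, greenPotential g₂ x * deriv (deriv φ) x = ∫ y, g₂ y * φ y := by
  have hφ := (contDiff_deriv_top (contDiff_deriv_top hs)).continuous
  obtain ⟨R, hR⟩ := hc.deriv.deriv.isCompact.isBounded.subset_closedBall 0
  have hint : Integrable (Function.uncurry fun x y => green x y * g₂ y * deriv (deriv φ) x)
      (volume.prod volume) := by
    refine Integrable.mono' (g := fun q : ℝ × ℝ => ‖deriv (deriv φ) q.1‖ *
      (R * ‖(Set.Icc (-R) R).indicator g₂ q.2‖)) ?_ ?_ (Eventually.of_forall fun q => ?_)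
    · exact (hφ.integrable_of_hasCompactSupport hc.deriv.deriv).norm.mul_prod
        ((integrable_indicator_Icc h R).norm.const_mul R)
    · exact (measurable_uncurry_green.aestronglyMeasurable.mul
        h.aestronglyMeasurable.comp_snd).mul (hφ.aestronglyMeasurable.comp_fst)
    · rw [Function.uncurry, norm_mul, mul_comm]
      by_cases hq : deriv (deriv φ) q.1 = 0
      · simp [hq]
      · gcongr
        refine norm_green_mul_le ?_ _
        simpa using hR (subset_tsupport _ hq)
  simp only [greenPotential, ← integral_mul_const]
  rw [integral_integral_swap hint]
  congr 1 with y
  simp only [mul_assoc, mul_left_comm (green _ _), integral_const_mul]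
  rw [integral_green_mul_deriv_deriv hs hc]

lemma IsDiffConvex.continuous {g : ℝ → ℝ} (h : IsDiffConvex g) : Continuous g := by
  obtain ⟨u, v, hu, hv, h⟩ := h
  rw [funext h]
  exact (continuousOn_univ.1 (hu.continuousOn isOpen_univ)).sub
    (continuousOn_univ.1 (hv.continuousOn isOpen_univ))

/-- A continuous function is the Green potential of its second distributional derivative, up to an
affine function. -/
lemma HasSecondDistribDeriv.exists_eq {ι : Type*} [Fintype ι] {g g₂ : ℝ → ℝ} {c z : ι → ℝ}
    (h : HasSecondDistribDeriv g g₂ c z) (hg : Continuous g) (h0 : g 0 = 0) :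
    ∃ b : ℝ, ∀ x, g x = b * x + greenPotential g₂ x + ∑ i, c i * green x (z i) := by
  have hN := continuous_greenPotential h.1
  have hS : Continuous fun x => ∑ i, c i * green x (z i) :=
    continuous_finsetSum _ fun i _ => continuous_const.mul (continuous_green _)
  obtain ⟨a, b, hab⟩ := exists_affine_of_integral_mul_deriv_deriv_eq_zero
    (g := fun x => g x - greenPotential g₂ x - ∑ i, c i * green x (z i))
    ((hg.sub hN).sub hS) fun φ hs hc => by
      have hφ := (contDiff_deriv_top (contDiff_deriv_top hs)).continuous
      have hcc := hc.deriv.deriv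
      have i1 := integrable_mul_test hg.locallyIntegrable hφ hcc
      have i2 := integrable_mul_test hN.locallyIntegrable hφ hcc
      have i3 := integrable_mul_test hS.locallyIntegrable hφ hcc
      simp only [sub_mul]
      have i12 : Integrable (fun x => g x * deriv (deriv φ) x -
        greenPotential g₂ x * deriv (deriv φ) x) := i1.sub i2
      rw [integral_sub i12 i3, integral_sub i1 i2, h.2 φ hs hc,
        integral_greenPotential_mul_deriv_deriv h.1 hs hc]
      simp only [Finset.sum_mul, mul_assoc]
      rw [integral_finsetSum _ fun i _ => (integrable_mul_test
        (continuous_green (z i)).locallyIntegrable hφ hcc).const_mul (c i)]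
      simp only [integral_const_mul, integral_green_mul_deriv_deriv hs hc]
      ring
  -- All kernels vanish at the origin, so the affine remainder has constant term $g(0)=0$.
  have hz : ∀ y, green 0 y = 0 := fun y => green_eq_zero (by simp)
  have ha : a = 0 := by
    have := hab 0
    simp [greenPotential, hz, h0] at this
    exact this.symm
  refine ⟨b, fun x => ?_⟩
  have := hab x
  rw [ha] at this
  linarith

/-! ### The Itô–Tanaka formula in expectation for a fixed parameter. -/

/-- The expectation of the Itô–Tanaka formula at a Gaussian time. -/
lemma HasSecondDistribDeriv.integral_gaussianReal {ι : Type*} [Fintype ι] {g g₂ : ℝ → ℝ}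
    {c z : ι → ℝ} (h : HasSecondDistribDeriv g g₂ c z) (hg : Continuous g) (h0 : g 0 = 0)
    {t : ℝ≥0} (ht : t ≠ 0) (hint : Integrable fun y => heat t y * g₂ y) :
    ∫ x, g x ∂(gaussianReal 0 t) =
      ((∫ y, expLocalTime t y * g₂ y) + ∑ i, expLocalTime t (z i) * c i) / 2 := by
  obtain ⟨b, hb⟩ := h.exists_eq hg h0
  have htpos : (0 : ℝ) < t := by positivity
  have hm := h.1.aestronglyMeasurable
  -- The kernel is nonnegative, so integrating the absolute value in $x$ first gives half the
  -- expected local time times $|g_2|$, integrable by `hint`.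
  have hprod : Integrable (Function.uncurry fun x y => green x y * g₂ y)
      ((gaussianReal 0 t).prod volume) := by
    have hmeas : AEStronglyMeasurable (Function.uncurry fun x y => green x y * g₂ y)
        ((gaussianReal 0 t).prod volume) :=
      measurable_uncurry_green.aestronglyMeasurable.mul hm.comp_snd
    refine (integrable_prod_iff' hmeas).2 ⟨Eventually.of_forall fun y =>
        (integrable_green_gaussianReal t y).mul_const (g₂ y), ?_⟩
    have h1 := (integrable_expLocalTime_mul measurable_id hm htpos hint).norm.div_const 2
    refine h1.congr (Eventually.of_forall fun y => ?_)
    simp only [Function.uncurry, norm_mul, integral_mul_const]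
    simp only [Real.norm_of_nonneg (green_nonneg _ _), integral_green_gaussianReal ht, id]
    rw [Real.norm_of_nonneg]
    · ring
    · have : 0 ≤ ∫ x, green x y ∂(gaussianReal 0 t) := integral_nonneg fun x => green_nonneg x y
      rw [integral_green_gaussianReal ht] at this
      linarith
  -- The centred linear term plays the part of the stochastic integral: it has mean zero.
  have i1 : Integrable (fun x => b * x) (gaussianReal 0 t) :=
    ((memLp_id_gaussianReal' (μ := 0) (v := t) 1 (by simp)).integrable le_rfl).const_mul b
  have i2 : Integrable (greenPotential g₂) (gaussianReal 0 t) := hprod.integral_prod_left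
  have i3 : ∀ i, Integrable (fun x => c i * green x (z i)) (gaussianReal 0 t) :=
    fun i => (integrable_green_gaussianReal t (z i)).const_mul (c i)
  simp only [hb]
  have i12 : Integrable (fun x => b * x + greenPotential g₂ x) (gaussianReal 0 t) := i1.add i2
  rw [integral_add i12 (integrable_finsetSum _ fun i _ => i3 i), integral_add i1 i2,
    integral_finsetSum _ fun i _ => i3 i, integral_const_mul, integral_id_gaussianReal]
  simp only [greenPotential]
  rw [integral_integral_swap hprod]
  simp only [integral_const_mul, integral_mul_const, integral_green_gaussianReal ht]
  rw [add_div, Finset.sum_div, ← integral_div]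
  simp only [mul_zero, zero_add, mul_div_assoc', mul_comm]

/-! ### Splitting off one coordinate of the parameter. -/

section Coordinates

lemma insertCoord_self {ι : Type*} [DecidableEq ι] (i : ι) (x : ℝ) (u : {j // j ≠ i} → ℝ) :
    insertCoord i x u i = x := by
  simp [insertCoord]

/-- Splitting off the `i`-th coordinate. -/
def splitCoord {ι : Type*} [DecidableEq ι] (i : ι) : (ι → ℝ) ≃ᵐ ℝ × ({j // j ≠ i} → ℝ) :=
  (MeasurableEquiv.piEquivPiSubtypeProd (fun _ => ℝ) (fun j => j = i)).trans
    ((MeasurableEquiv.funUnique {j // j = i} ℝ).prodCongr (MeasurableEquiv.refl _))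

lemma measurableEmbedding_insertCoord {ι : Type*} [DecidableEq ι] (i : ι) :
    MeasurableEmbedding (fun q : ℝ × ({j // j ≠ i} → ℝ) => insertCoord i q.1 q.2) :=
  (splitCoord i).symm.measurableEmbedding

variable {ι : Type*} [DecidableEq ι] [Fintype ι]

lemma measurePreserving_splitCoord (i : ι) :
    MeasurePreserving (splitCoord i) volume (volume.prod volume) := by
  have h1 : MeasurePreserving (MeasurableEquiv.piEquivPiSubtypeProd (fun _ : ι => ℝ)
      (fun j => j = i)) volume (volume.prod (volume : Measure ({j // j ≠ i} → ℝ))) := by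
    convert! volume_preserving_piEquivPiSubtypeProd (fun _ : ι => ℝ) (fun j => j = i) using 1
    rw [Measure.volume_eq_prod]
    congr!
  have h2 : MeasurePreserving (MeasurableEquiv.funUnique {j // j = i} ℝ) volume volume := by
    convert! volume_preserving_funUnique {j // j = i} ℝ
  exact (h2.prod (MeasurePreserving.id (volume : Measure ({j // j ≠ i} → ℝ)))).comp h1

lemma measurePreserving_insertCoord (i : ι) :
    MeasurePreserving (fun q : ℝ × ({j // j ≠ i} → ℝ) => insertCoord i q.1 q.2)
      (volume.prod volume) volume :=
  (measurePreserving_splitCoord i).symm (splitCoord i)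

/-- Making the $i$-th coordinate Gaussian and the others Lebesgue amounts to weighting Lebesgue
measure by the density at $z_i$. This links the Dirac mass at $z_i$ to a weight evaluated at $W_t$.
-/
lemma integrable_gaussianReal_insertCoord_iff (i : ι) (F : (ι → ℝ) → ℝ) {t : ℝ≥0} (ht : t ≠ 0) :
    Integrable (fun q : ℝ × ({j // j ≠ i} → ℝ) => F (insertCoord i q.1 q.2))
      ((gaussianReal 0 t).prod volume) ↔ Integrable (fun z => heat t (z i) * F z) := by
  rw [integrable_gaussianReal_prod_iff _ ht,
    ← (measurePreserving_insertCoord i).integrable_comp_emb (measurableEmbedding_insertCoord i)]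
  simp only [Function.comp_def, insertCoord_self]

lemma integral_gaussianReal_insertCoord (i : ι) (F : (ι → ℝ) → ℝ) {t : ℝ≥0} (ht : t ≠ 0) :
    ∫ q : ℝ × ({j // j ≠ i} → ℝ), F (insertCoord i q.1 q.2) ∂((gaussianReal 0 t).prod volume) =
      ∫ z, heat t (z i) * F z := by
  rw [integral_gaussianReal_prod _ ht,
    ← (measurePreserving_insertCoord i).integral_comp (measurableEmbedding_insertCoord i)]
  simp only [insertCoord_self]

/-- Where the marginal density vanishes, so does almost every fibre of the density: the averaged
weight is the plain integral of the weight against the joint density. -/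
lemma avgWeight_ae_eq {ρ : (ι → ℝ) → ℝ} (hρ : Integrable ρ) (hρ0 : ∀ z, 0 ≤ ρ z)
    (γ : ι → (ι → ℝ) → ℝ) (i : ι) :
    ∀ᵐ x, avgWeight ρ γ i x = ∫ u, γ i (insertCoord i x u) * ρ (insertCoord i x u) := by
  have h : Integrable (fun q : ℝ × ({j // j ≠ i} → ℝ) => ρ (insertCoord i q.1 q.2))
      (volume.prod volume) := (measurePreserving_insertCoord i).integrable_comp_of_integrable hρ
  filter_upwards [h.prod_right_ae] with x hx
  unfold avgWeight
  rw [← integral_mul_const]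
  by_cases hm : marginalDensity ρ i x = 0
  · have h0 := (integral_eq_zero_iff_of_nonneg (fun u => hρ0 _) hx).1 hm
    refine integral_congr_ae ?_
    filter_upwards [h0] with u hu
    have hu' : ρ (insertCoord i x u) = 0 := hu
    rw [hm, hu', mul_zero, mul_zero]
  · congr 1 with u
    rw [condDensity, mul_assoc, div_mul_cancel₀ _ hm]

/-- Fubini over the split coordinates. The fibrewise formula for the averaged weight holds only
Lebesgue-almost everywhere, which suffices since the Gaussian law is absolutely continuous. -/
lemma integral_avgWeight_gaussianReal {ρ : (ι → ℝ) → ℝ} (hρ : Integrable ρ) (hρ0 : ∀ z, 0 ≤ ρ z)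
    (γ : ι → (ι → ℝ) → ℝ) (i : ι) {t : ℝ≥0} (ht : t ≠ 0)
    (hint : Integrable (fun z => heat t (z i) * (γ i z * ρ z))) :
    ∫ x, avgWeight ρ γ i x ∂(gaussianReal 0 t) = ∫ z, heat t (z i) * (γ i z * ρ z) := by
  rw [← integral_gaussianReal_insertCoord i (fun z => γ i z * ρ z) ht, integral_prod _
    ((integrable_gaussianReal_insertCoord_iff i (fun z => γ i z * ρ z) ht).2 hint)]
  exact integral_congr_ae
    ((gaussianReal_absolutelyContinuous 0 ht).ae_le (avgWeight_ae_eq hρ hρ0 γ i))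

end Coordinates

/-! ### Averaging the formula over the parameter. -/

/-- The Itô–Tanaka formula in expectation, averaged over the parameter. -/
lemma integral_eq_of_hasSecondDistribDeriv {ι : Type*} [Fintype ι] {μ : Measure (ι → ℝ)}
    [SFinite μ] {f f₂ : ℝ → (ι → ℝ) → ℝ} {γ : ι → (ι → ℝ) → ℝ}
    (hf₂ : Measurable (Function.uncurry f₂)) (hγ : ∀ i, Measurable (γ i)) {t : ℝ≥0} (ht : t ≠ 0)
    (hf_int : Integrable (Function.uncurry f) ((gaussianReal 0 t).prod μ))
    (hf₂_int : Integrable (Function.uncurry f₂) ((gaussianReal 0 t).prod μ))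
    (hγ_int : ∀ i, Integrable (fun z => heat t (z i) * γ i z) μ)
    (h1 : ∀ z, Continuous (fun x => f x z)) (h2 : ∀ z, f 0 z = 0)
    (h4 : ∀ z, HasSecondDistribDeriv (fun x => f x z) (fun x => f₂ x z) (fun i => γ i z) z) :
    ∫ q, f q.1 q.2 ∂((gaussianReal 0 t).prod μ) =
      ((∫ s in 0..(t : ℝ), ∫ q : ℝ × (ι → ℝ), heat s q.1 * f₂ q.1 q.2 ∂(volume.prod μ)) +
        ∑ i, ∫ s in 0..(t : ℝ), ∫ z, heat s (z i) * γ i z ∂μ) / 2 := by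
  have htpos : (0 : ℝ) < t := by positivity
  rw [integrable_gaussianReal_prod_iff μ ht] at hf₂_int
  have i1 := integrable_expLocalTime_mul measurable_fst hf₂.aestronglyMeasurable htpos hf₂_int
  have i2 : ∀ i, Integrable (fun z => expLocalTime t (z i) * γ i z) μ := fun i =>
    integrable_expLocalTime_mul (measurable_pi_apply i) (hγ i).aestronglyMeasurable htpos (hγ_int i)
  have e1 := integral_expLocalTime_mul measurable_fst hf₂.aestronglyMeasurable htpos hf₂_int
  have e2 : ∀ i, _ := fun i => integral_expLocalTime_mul (measurable_pi_apply i)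
    (hγ i).aestronglyMeasurable htpos (hγ_int i)
  simp only [Function.uncurry] at e1
  rw [← e1]
  simp only [← e2]
  have i3 : Integrable (fun z => ∫ y, expLocalTime t y * f₂ y z) μ := i1.integral_prod_right
  rw [integral_prod_symm (fun q : ℝ × (ι → ℝ) => f q.1 q.2) hf_int,
    integral_prod_symm (fun q : ℝ × (ι → ℝ) => expLocalTime t q.1 * f₂ q.1 q.2) i1,
    ← integral_finsetSum _ fun i _ => i2 i,
    ← integral_add i3 (integrable_finsetSum _ fun i _ => i2 i),
    ← integral_div]
  refine integral_congr_ae ?_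
  -- Joint integrability provides the integrability required by the fixed-parameter formula for
  -- almost every $z$ only.
  filter_upwards [hf₂_int.prod_left_ae] with z hz
  exact (h4 z).integral_gaussianReal (h1 z) (h2 z) ht hz

/-! ### Small-time estimates for Gaussian means. -/

/-- Scaling by $\sqrt s$ produces the factor $(\sqrt s)^{n+2}=(\sqrt s)^n s\le s$; an exponent of at
least two is what yields a full power of $s$. -/
lemma integral_pow_abs_gaussianReal_le (n : ℕ) {s : ℝ≥0} (hs : s ≤ 1) :
    ∫ x, |x| ^ (n + 2) ∂(gaussianReal 0 s) ≤ s * ∫ x, |x| ^ (n + 2) ∂(gaussianReal 0 1) := by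
  have hmap : gaussianReal 0 s = (gaussianReal 0 1).map (fun x => √s * x) := by
    rw [gaussianReal_map_const_mul]
    congr 1
    · simp
    · ext
      simp
  rw [hmap, integral_map (by fun_prop) (by fun_prop)]
  simp only [abs_mul, mul_pow, integral_const_mul]
  refine mul_le_mul_of_nonneg_right ?_ (integral_nonneg fun x => by positivity)
  rw [abs_of_nonneg (Real.sqrt_nonneg _), pow_add, Real.sq_sqrt s.coe_nonneg]
  exact mul_le_of_le_one_left s.coe_nonneg (pow_le_one₀ (Real.sqrt_nonneg _)
    (Real.sqrt_le_one.2 (by exact_mod_cast hs)))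

/-- The mean value inequality is applied twice on $[-|x|,|x|]$, so the second derivative need not be
continuous. -/
lemma abs_sub_linear_le_of_deriv_deriv_le {h : ℝ → ℝ} (hd : Differentiable ℝ h)
    (hd' : Differentiable ℝ (deriv h)) (h0 : h 0 = 0) {C : ℝ} {k : ℕ}
    (hC : ∀ x, |deriv (deriv h) x| ≤ C * (1 + |x| ^ k)) (x : ℝ) :
    |h x - deriv h 0 * x| ≤ C * (|x| ^ 2 + |x| ^ (k + 2)) := by
  have hC0 : 0 ≤ C := by
    have h1 := (abs_nonneg _).trans (hC 0)
    exact nonneg_of_mul_nonneg_left h1 (by positivity)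
  set s := Set.Icc (-|x|) |x|
  have hs : Convex ℝ s := convex_Icc _ _
  have h0s : (0 : ℝ) ∈ s := ⟨by simp, by simp⟩
  have hxs : x ∈ s := ⟨neg_abs_le x, le_abs_self x⟩
  have b2 : ∀ y ∈ s, ‖deriv (deriv h) y‖ ≤ C * (1 + |x| ^ k) := fun y hy => by
    have : |y| ≤ |x| := abs_le.2 hy
    exact (hC y).trans (by gcongr)
  have b1 : ∀ y ∈ s, ‖deriv h y - deriv h 0‖ ≤ C * (1 + |x| ^ k) * |x| := fun y hy => by
    have h3 := hs.norm_image_sub_le_of_norm_hasDerivWithin_le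
      (fun z _ => (hd' z).hasDerivAt.hasDerivWithinAt) b2 h0s hy
    refine h3.trans ?_
    have : |y| ≤ |x| := abs_le.2 hy
    rw [sub_zero, Real.norm_eq_abs]
    gcongr
  have h3 := hs.norm_image_sub_le_of_norm_hasDerivWithin_le
    (f := fun y => h y - deriv h 0 * y) (f' := fun y => deriv h y - deriv h 0)
    (fun z _ => by
      have h4 := (hasDerivAt_id z).const_mul (deriv h 0)
      rw [mul_one] at h4
      exact ((hd z).hasDerivAt.sub h4).hasDerivWithinAt) b1 h0s hxs
  simp only [h0, mul_zero, sub_zero, Real.norm_eq_abs] at h3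
  refine h3.trans_eq ?_
  ring

/-- A twice differentiable function vanishing at `0` whose second derivative has polynomial growth
has Gaussian means of the order of the variance. -/
lemma exists_abs_integral_gaussianReal_le {h : ℝ → ℝ} (hd : Differentiable ℝ h)
    (hd' : Differentiable ℝ (deriv h)) (h0 : h 0 = 0) (hg : PolyGrowth (deriv (deriv h))) :
    ∃ C : ℝ, ∀ s : ℝ≥0, s ≤ 1 → |∫ x, h x ∂(gaussianReal 0 s)| ≤ C * s := by
  obtain ⟨C, k, hC⟩ := hg
  have hb := abs_sub_linear_le_of_deriv_deriv_le hd hd' h0 hC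
  have hC0 : 0 ≤ C := by
    have h1 := (abs_nonneg _).trans (hC 0)
    exact nonneg_of_mul_nonneg_left h1 (by positivity)
  refine ⟨C * ((∫ x, |x| ^ 2 ∂(gaussianReal 0 1)) + ∫ x, |x| ^ (k + 2) ∂(gaussianReal 0 1)),
    fun s hs => ?_⟩
  have i1 : Integrable (fun x : ℝ => deriv h 0 * x) (gaussianReal 0 s) :=
    ((memLp_id_gaussianReal' (μ := 0) (v := s) 1 (by simp)).integrable le_rfl).const_mul _
  have i2 := (integrable_pow_abs_gaussianReal 2 s)
  have i3 := (integrable_pow_abs_gaussianReal (k + 2) s)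
  have i23 : Integrable (fun x : ℝ => |x| ^ 2 + |x| ^ (k + 2)) (gaussianReal 0 s) := i2.add i3
  have i4 : Integrable (fun x => h x - deriv h 0 * x) (gaussianReal 0 s) :=
    (i23.const_mul C).mono' (hd.continuous.sub (by fun_prop)).aestronglyMeasurable
      (Eventually.of_forall hb)
  -- The first-order term, of size $\sqrt s$, has mean zero; only the quadratic remainder is left.
  have e : ∫ x, h x ∂(gaussianReal 0 s) = ∫ x, (h x - deriv h 0 * x) ∂(gaussianReal 0 s) := by
    have i5 : Integrable h (gaussianReal 0 s) := (i4.add i1).congr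
      (Eventually.of_forall fun x => by simp)
    rw [integral_sub i5 i1, integral_const_mul, integral_id_gaussianReal, mul_zero, sub_zero]
  calc |∫ x, h x ∂(gaussianReal 0 s)|
      ≤ ∫ x, C * (|x| ^ 2 + |x| ^ (k + 2)) ∂(gaussianReal 0 s) := by
        rw [e]
        exact norm_integral_le_of_norm_le (f := fun x => h x - deriv h 0 * x) (i23.const_mul C)
          (Eventually.of_forall hb)
    _ = C * ((∫ x, |x| ^ 2 ∂(gaussianReal 0 s)) + ∫ x, |x| ^ (k + 2) ∂(gaussianReal 0 s)) := by
        rw [integral_const_mul, integral_add i2 i3]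
    _ ≤ C * (s * (∫ x, |x| ^ 2 ∂(gaussianReal 0 1)) +
          s * ∫ x, |x| ^ (k + 2) ∂(gaussianReal 0 1)) := by
        gcongr
        · exact integral_pow_abs_gaussianReal_le 0 hs
        · exact integral_pow_abs_gaussianReal_le k hs
    _ = _ := by ring

lemma eventually_forall_Ioc {p : ℝ≥0 → Prop} (h : ∀ᶠ s in 𝓝[>] (0 : ℝ≥0), p s) :
    ∀ᶠ t in 𝓝[>] (0 : ℝ≥0), ∀ s ∈ Set.Ioc 0 t, p s := by
  obtain ⟨δ, hδ, hp⟩ := (nhdsGT_basis (0 : ℝ≥0)).eventually_iff.1 h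
  filter_upwards [Ioo_mem_nhdsGT hδ] with t ht s hs
  exact hp ⟨hs.1, hs.2.trans_lt ht.2⟩

/-- For small $t$ the bound holds on all of $(0,t]$, where $s^n\le t^n$; the length of the interval
supplies the extra power. -/
lemma isBigO_intervalIntegral {a : ℝ → ℝ} {n : ℕ} {C : ℝ}
    (h : ∀ᶠ s : ℝ≥0 in 𝓝[>] (0 : ℝ≥0), |a (s : ℝ)| ≤ C * (s : ℝ) ^ n) :
    (fun t : ℝ≥0 => ∫ s in 0..(t : ℝ), a s) =O[𝓝[>] 0] (fun t : ℝ≥0 => (t : ℝ) ^ (n + 1)) := by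
  refine Asymptotics.IsBigO.of_bound |C| ?_
  filter_upwards [eventually_forall_Ioc h] with t ht
  have := intervalIntegral.norm_integral_le_of_norm_le_const (a := 0) (b := (t : ℝ)) (f := a)
    (C := |C| * (t : ℝ) ^ n) fun s hs => by
      rw [Set.uIoc_of_le t.coe_nonneg] at hs
      lift s to ℝ≥0 using hs.1.le
      have hs1 : 0 < s := by exact_mod_cast hs.1
      have hs2 : s ≤ t := by exact_mod_cast hs.2
      refine (ht s ⟨hs1, hs2⟩).trans ?_
      have := le_abs_self C
      gcongr
  refine this.trans_eq ?_
  rw [sub_zero, abs_of_nonneg t.coe_nonneg, Real.norm_of_nonneg (by positivity)]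
  ring

/-! ### Transfer between random variables, laws and densities. -/

section Law

variable {Ω X : Type*} [MeasurableSpace Ω] [MeasurableSpace X] {P : Measure Ω} {B : Ω → ℝ}

/-- Replacing an almost everywhere measurable Gaussian variable by its law in a product. -/
lemma integrable_gaussianReal_prod_of_comp [SFinite P] {ν : Measure X} [SFinite ν]
    {F : ℝ × X → ℝ} (hF : Measurable F) {v : ℝ≥0} (hB : HasLaw B (gaussianReal 0 v) P)
    (h : Integrable (fun p : Ω × X => F (B p.1, p.2)) (P.prod ν)) :
    Integrable F ((gaussianReal 0 v).prod ν) := by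
  obtain ⟨B', hB', hBB'⟩ := hB.aemeasurable
  have h1 : P.map B' = gaussianReal 0 v := by rw [← Measure.map_congr hBB', hB.map_eq]
  have h2 : MeasurePreserving (Prod.map B' id) (P.prod ν) ((gaussianReal 0 v).prod ν) :=
    (⟨hB', h1⟩ : MeasurePreserving B' P (gaussianReal 0 v)).prod (MeasurePreserving.id ν)
  refine (h2.integrable_comp hF.aestronglyMeasurable).1 (h.congr ?_)
  have h3 : ∀ᵐ p : Ω × X ∂(P.prod ν), B p.1 = B' p.1 :=
    Measure.quasiMeasurePreserving_fst.ae hBB'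
  filter_upwards [h3] with p hp
  simp only [Function.comp_apply, Prod.map, id, hp]

lemma map_prodMk_eq_of_indepFun [IsProbabilityMeasure P] {G : Ω → X} (hG : Measurable G) {v : ℝ≥0}
    (hB : HasLaw B (gaussianReal 0 v) P) (hBG : IndepFun B G P) :
    P.map (fun ω => (B ω, G ω)) = (gaussianReal 0 v).prod (P.map G) := by
  rw [(indepFun_iff_map_prod_eq_prod_map_map hB.aemeasurable hG.aemeasurable).1 hBG, hB.map_eq]

end Law

section Density

variable {ι : Type*} [Fintype ι] {μ : Measure (ι → ℝ)} {ρ : (ι → ℝ) → ℝ}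

lemma integrable_density [IsFiniteMeasure μ] (hρ : Measurable ρ) (hρ0 : ∀ z, 0 ≤ ρ z)
    (hμ : μ = volume.withDensity (fun z => ENNReal.ofReal (ρ z))) : Integrable ρ := by
  refine ⟨hρ.aestronglyMeasurable, ?_⟩
  rw [hasFiniteIntegral_iff_ofReal (Eventually.of_forall hρ0)]
  have := measure_lt_top μ Set.univ
  rwa [hμ, withDensity_apply _ MeasurableSet.univ, setLIntegral_univ] at this

lemma integrable_iff_of_density (hρ : Measurable ρ) (hρ0 : ∀ z, 0 ≤ ρ z)
    (hμ : μ = volume.withDensity (fun z => ENNReal.ofReal (ρ z))) (F : (ι → ℝ) → ℝ) :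
    Integrable F μ ↔ Integrable (fun z => F z * ρ z) := by
  rw [hμ, integrable_withDensity_iff_integrable_smul' hρ.ennreal_ofReal (by simp)]
  simp [ENNReal.toReal_ofReal (hρ0 _), mul_comm]

lemma integral_eq_of_density (hρ : Measurable ρ) (hρ0 : ∀ z, 0 ≤ ρ z)
    (hμ : μ = volume.withDensity (fun z => ENNReal.ofReal (ρ z))) (F : (ι → ℝ) → ℝ) :
    ∫ z, F z ∂μ = ∫ z, F z * ρ z := by
  rw [hμ, integral_withDensity_eq_integral_toReal_smul hρ.ennreal_ofReal (by simp)]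
  simp [ENNReal.toReal_ofReal (hρ0 _), mul_comm]

lemma measurable_insertCoord {ι : Type*} [DecidableEq ι] (i : ι) :
    Measurable (fun q : ℝ × ({j // j ≠ i} → ℝ) => insertCoord i q.1 q.2) :=
  (measurableEmbedding_insertCoord i).measurable

variable [DecidableEq ι]

lemma aestronglyMeasurable_avgWeight (hρ : Integrable ρ) (hρm : Measurable ρ)
    (hρ0 : ∀ z, 0 ≤ ρ z) {γ : ι → (ι → ℝ) → ℝ} (hγ : ∀ i, Measurable (γ i)) (i : ι) :
    AEStronglyMeasurable (avgWeight ρ γ i) volume := by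
  have h : Measurable (fun q : ℝ × ({j // j ≠ i} → ℝ) =>
      γ i (insertCoord i q.1 q.2) * ρ (insertCoord i q.1 q.2)) :=
    ((hγ i).comp (measurable_insertCoord i)).mul (hρm.comp (measurable_insertCoord i))
  exact h.stronglyMeasurable.integral_prod_right'.aestronglyMeasurable.congr
    (EventuallyEq.symm (avgWeight_ae_eq hρ hρ0 γ i))

end Density

lemma eventually_ne_zero : ∀ᶠ t in 𝓝[>] (0 : ℝ≥0), t ≠ 0 := by
  filter_upwards [self_mem_nhdsWithin] with t ht using ne_of_gt ht

end ItoTanaka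

/-! ### Assembly of the two asymptotic bounds. -/

open ItoTanaka in
theorem mainTheorem8 {Ω : Type*} [MeasurableSpace Ω] (P : Measure Ω) [IsProbabilityMeasure P]
    (d : ℕ)
    -- a standard Brownian motion and an independent random vector with a density
    (W : ℝ≥0 → Ω → ℝ) (hW : IsBrownianReal W P)
    (G : Ω → Fin (2 * d) → ℝ) (hG : Measurable G)
    (fG : (Fin (2 * d) → ℝ) → ℝ) (hfG : Measurable fG) (hfG_nonneg : ∀ z, 0 ≤ fG z)
    (hG_law : P.map G = volume.withDensity (fun z => ENNReal.ofReal (fG z)))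
    (hWG : IndepFun (fun ω t => W t ω) G P)
    -- the function, the density `f₂ x z = f_z''(x)` and the weights of the Dirac masses
    (f f₂ : ℝ → (Fin (2 * d) → ℝ) → ℝ) (γ : Fin (2 * d) → (Fin (2 * d) → ℝ) → ℝ)
    (hf : Measurable (Function.uncurry f)) (hf₂ : Measurable (Function.uncurry f₂))
    (hγ : ∀ i, Measurable (γ i))
    -- the expectations at small times are absolutely convergent
    (hf_int : ∀ᶠ t in 𝓝[>] (0 : ℝ≥0), Integrable (fun ω => f (W t ω) (G ω)) P)
    (hf₂_int : ∀ᶠ t in 𝓝[>] (0 : ℝ≥0), Integrable (fun ω => f₂ (W t ω) (G ω)) P)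
    (hγ_int : ∀ i, ∀ᶠ t in 𝓝[>] (0 : ℝ≥0),
      Integrable (fun p : Ω × ({j // j ≠ i} → ℝ) =>
        γ i (ItoTanaka.insertCoord i (W t p.1) p.2) *
          fG (ItoTanaka.insertCoord i (W t p.1) p.2)) (P.prod volume))
    -- Conditions 1 to 4
    (h1 : ∀ z, ItoTanaka.IsDiffConvex (fun x => f x z))
    (h2 : ∀ z, f 0 z = 0)
    (h3 : ∀ z, ItoTanaka.PolyGrowth (ItoTanaka.leftDeriv (fun x => f x z)))
    (h4 : ∀ z, ItoTanaka.HasSecondDistribDeriv (fun x => f x z) (fun x => f₂ x z)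
      (fun i => γ i z) z) :
    -- Conditions 5 and 6 give `O(t)`
    (((∃ C : ℝ, ∀ᶠ t in 𝓝[>] (0 : ℝ≥0), |∫ ω, f₂ (W t ω) (G ω) ∂P| ≤ C) ∧
        (∀ i, ∃ C : ℝ, ∀ᶠ t in 𝓝[>] (0 : ℝ≥0),
          |∫ ω, ItoTanaka.avgWeight fG γ i (W t ω) ∂P| ≤ C)) →
      (fun t : ℝ≥0 => ∫ ω, f (W t ω) (G ω) ∂P) =O[𝓝[>] 0] (fun t : ℝ≥0 => (t : ℝ))) ∧
    -- Conditions 5' and 6' give `O(t ^ 2)`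
    (((ItoTanaka.avgDensity P G f₂ 0 = 0 ∧
          Differentiable ℝ (ItoTanaka.avgDensity P G f₂) ∧
          Differentiable ℝ (deriv (ItoTanaka.avgDensity P G f₂)) ∧
          ItoTanaka.PolyGrowth (deriv (ItoTanaka.avgDensity P G f₂)) ∧
          ItoTanaka.PolyGrowth (deriv (deriv (ItoTanaka.avgDensity P G f₂)))) ∧
        (∀ i, ItoTanaka.avgWeight fG γ i 0 = 0 ∧
          ContDiff ℝ 2 (ItoTanaka.avgWeight fG γ i) ∧
          ItoTanaka.PolyGrowth (deriv (ItoTanaka.avgWeight fG γ i)) ∧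
          ItoTanaka.PolyGrowth (deriv (deriv (ItoTanaka.avgWeight fG γ i))))) →
      (fun t : ℝ≥0 => ∫ ω, f (W t ω) (G ω) ∂P) =O[𝓝[>] 0] (fun t : ℝ≥0 => (t : ℝ) ^ 2)) := by
  set μ := P.map G
  have : IsProbabilityMeasure μ := Measure.isProbabilityMeasure_map hG.aemeasurable
  have hlaw : ∀ t, HasLaw (W t) (gaussianReal 0 t) P := hW.toIsPreBrownianReal.hasLaw_eval
  have hpair : ∀ t, AEMeasurable (fun ω => (W t ω, G ω)) P :=
    fun t => (hlaw t).aemeasurable.prodMk hG.aemeasurable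
  have hmap : ∀ t, P.map (fun ω => (W t ω, G ω)) = (gaussianReal 0 t).prod μ := fun t =>
    map_prodMk_eq_of_indepFun hG (hlaw t) (hWG.comp (measurable_pi_apply t) measurable_id)
  have hint : ∀ (F : ℝ → (Fin (2 * d) → ℝ) → ℝ) (t : ℝ≥0), Measurable (Function.uncurry F) →
      Integrable (fun ω => F (W t ω) (G ω)) P →
      Integrable (Function.uncurry F) ((gaussianReal 0 t).prod μ) := fun F t hF h => by
    rw [← hmap t]
    exact (integrable_map_measure hF.aestronglyMeasurable (hpair t)).2 h
  have heq : ∀ (F : ℝ → (Fin (2 * d) → ℝ) → ℝ) (t : ℝ≥0), Measurable (Function.uncurry F) →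
      ∫ ω, F (W t ω) (G ω) ∂P = ∫ q, F q.1 q.2 ∂((gaussianReal 0 t).prod μ) := fun F t hF => by
    rw [← hmap t]
    exact (integral_map (hpair t) hF.aestronglyMeasurable).symm
  have hfGi : Integrable fG := integrable_density hfG hfG_nonneg hG_law
  have hγi : ∀ i, ∀ᶠ t : ℝ≥0 in 𝓝[>] (0 : ℝ≥0),
      Integrable (fun z => heat t (z i) * (γ i z * fG z)) := fun i => by
    filter_upwards [hγ_int i, eventually_ne_zero] with t ht ht0
    rw [← integrable_gaussianReal_insertCoord_iff i (fun z => γ i z * fG z) ht0]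
    exact integrable_gaussianReal_prod_of_comp
      (((hγ i).comp (measurable_insertCoord i)).mul (hfG.comp (measurable_insertCoord i)))
      (hlaw t) ht
  -- For small $s>0$, `a s` is $\mathbb{E}f_G''(W_s)$ and `b i s` is $\mathbb{E}h_i(W_s)$, written
  -- as functions of a real time so that they can be integrated.
  let a : ℝ → ℝ := fun s => ∫ q : ℝ × (Fin (2 * d) → ℝ), heat s q.1 * f₂ q.1 q.2 ∂(volume.prod μ)
  let b : Fin (2 * d) → ℝ → ℝ := fun i s => ∫ z, heat s (z i) * γ i z ∂μ
  have ha : ∀ s : ℝ≥0, s ≠ 0 → ∫ ω, f₂ (W s ω) (G ω) ∂P = a s := fun s hs => by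
    rw [heq f₂ s hf₂, integral_gaussianReal_prod μ hs]
  have hb' : ∀ i, ∀ᶠ s : ℝ≥0 in 𝓝[>] (0 : ℝ≥0),
      ∫ x, avgWeight fG γ i x ∂(gaussianReal 0 s) = b i s := fun i => by
    filter_upwards [hγi i, eventually_ne_zero] with s hs hs0
    rw [integral_avgWeight_gaussianReal hfGi hfG_nonneg γ i hs0 hs]
    simp only [b, integral_eq_of_density hfG hfG_nonneg hG_law, mul_assoc]
  have hb : ∀ i, ∀ᶠ s : ℝ≥0 in 𝓝[>] (0 : ℝ≥0),
      ∫ ω, avgWeight fG γ i (W s ω) ∂P = b i s := fun i => by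
    filter_upwards [hb' i, eventually_ne_zero] with s hs hs0
    rw [← hs, ← (hlaw s).map_eq]
    refine (integral_map (hlaw s).aemeasurable ?_).symm
    rw [(hlaw s).map_eq]
    exact (aestronglyMeasurable_avgWeight hfGi hfG hfG_nonneg hγ i).mono_ac
      (gaussianReal_absolutelyContinuous 0 hs0)
  have hmain : ∀ᶠ t : ℝ≥0 in 𝓝[>] (0 : ℝ≥0), ∫ ω, f (W t ω) (G ω) ∂P =
      ((∫ s in 0..(t : ℝ), a s) + ∑ i, ∫ s in 0..(t : ℝ), b i s) / 2 := by
    filter_upwards [hf_int, hf₂_int, eventually_all.2 hγi, eventually_ne_zero] with t h1t h2t h3t ht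
    rw [heq f t hf]
    refine integral_eq_of_hasSecondDistribDeriv hf₂ hγ ht (hint f t hf h1t) (hint f₂ t hf₂ h2t)
      (fun i => ?_) (fun z => (h1 z).continuous) h2 h4
    rw [integrable_iff_of_density hfG hfG_nonneg hG_law]
    simpa only [mul_assoc] using h3t i
  -- Part (a) is the case $n=0$ and part (b) the case $n=1$.
  have hfinal : ∀ n : ℕ, (∃ C, ∀ᶠ s : ℝ≥0 in 𝓝[>] (0 : ℝ≥0), |a s| ≤ C * (s : ℝ) ^ n) →
      (∀ i, ∃ C, ∀ᶠ s : ℝ≥0 in 𝓝[>] (0 : ℝ≥0), |b i s| ≤ C * (s : ℝ) ^ n) →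
      (fun t : ℝ≥0 => ∫ ω, f (W t ω) (G ω) ∂P) =O[𝓝[>] 0]
        (fun t : ℝ≥0 => (t : ℝ) ^ (n + 1)) := by
    rintro n ⟨C, hC⟩ hCb
    have h1 := isBigO_intervalIntegral hC
    have h2 : ∀ i, (fun t : ℝ≥0 => ∫ s in 0..(t : ℝ), b i s) =O[𝓝[>] 0]
        (fun t : ℝ≥0 => (t : ℝ) ^ (n + 1)) := fun i =>
      isBigO_intervalIntegral (hCb i).choose_spec
    refine Asymptotics.IsBigO.congr' ((h1.add (Asymptotics.IsBigO.sum
      (s := Finset.univ) fun i _ => h2 i)).const_mul_left (1 / 2)) ?_ EventuallyEq.rfl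
    filter_upwards [hmain] with t ht
    rw [ht, Finset.sum_apply]
    ring
  have hle : ∀ᶠ s in 𝓝[>] (0 : ℝ≥0), s ≤ 1 :=
    mem_nhdsWithin_of_mem_nhds (Iic_mem_nhds one_pos)
  constructor
  · rintro ⟨⟨C, hC⟩, hCb⟩
    simpa using hfinal 0 ⟨C, by
      filter_upwards [hC, eventually_ne_zero] with s hs hs0
      rwa [pow_zero, mul_one, ← ha s hs0]⟩ fun i => by
        obtain ⟨C, hC⟩ := hCb i
        refine ⟨C, ?_⟩
        filter_upwards [hC, hb i] with s hs hbs
        rwa [pow_zero, mul_one, ← hbs]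
  · rintro ⟨⟨h0, hd, hd', -, hg⟩, hw⟩
    refine hfinal 1 ?_ fun i => ?_
    · obtain ⟨C, hC⟩ := exists_abs_integral_gaussianReal_le hd hd' h0 hg
      refine ⟨C, ?_⟩
      filter_upwards [hf₂_int, eventually_ne_zero, hle] with s hs hs0 hs1
      have h5 := hint f₂ s hf₂ hs
      have h6 : avgDensity P G f₂ = fun x => ∫ z, f₂ x z ∂μ := funext fun x =>
        (integral_map hG.aemeasurable
          (hf₂.comp measurable_prodMk_left).aestronglyMeasurable).symm
      -- Integrating over the parameter first turns $\mathbb{E}f_G''(W_s)$ into the Gaussian mean of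
      -- $h_0$.
      rw [← ha s hs0, heq f₂ s hf₂, integral_prod (fun q => f₂ q.1 q.2) h5, pow_one]
      simpa only [h6] using hC s hs1
    · obtain ⟨h0, hcd, -, hg⟩ := hw i
      have hd := hcd.differentiable two_ne_zero
      have hd' : Differentiable ℝ (deriv (avgWeight fG γ i)) :=
        ((contDiff_succ_iff_deriv (n := 1)).1
          (by rwa [one_add_one_eq_two])).2.2.differentiable one_ne_zero
      obtain ⟨C, hC⟩ := exists_abs_integral_gaussianReal_le hd hd' h0 hg
      refine ⟨C, ?_⟩
      filter_upwards [hb' i, hle] with s hbs hs1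
      rw [← hbs, pow_one]
      exact hC s hs1
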